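/- A (finite) Markov decision process (MDP) $G$ consists of a finite directed graph whose vertex set is the disjoint union of agent vertices $V_A$ and randomization vertices $V_R$, every vertex having at least one outgoing edge, of a reward $r(e)\in\mathbb R$ for every edge $e$ leaving an agent vertex (agent edge), and of a probability $p(e)\in[0,1]$ for every edge leaving a randomization vertex, the probabilities at each randomization vertex summing to one. The size of $G$ is its number of vertices plus its number of edges. A sink is an agent vertex $s$, reachable from all vertices, whose only outgoing edge is a self-loop with reward zero. A policy $\pi$ chooses an outgoing edge $(v,\pi(v))$ in every $v\in V_A$; it is weak unichain if $G$ has a sink that is reached with probability one under $\pi$ from every starting vertex. The values of a weak unichain policy are the unique solution of $\mathrm{Val}_\pi(u)=r(u,\pi(u))+\mathrm{Val}_\pi(\pi(u))$ for $u\in V_A$, $\mathrm{Val}_\pi(u)=\sum_{v}p(u,v)\mathrm{Val}_\pi(v)$ for $u\in V_R$, and $\mathrm{Val}_\pi(s)=0$ for the sink $s$. An agent edge $e=(u,v)$ is an improving switch for $\pi$ if its reduced cost $z_\pi(e)=r(e)+\mathrm{Val}_\pi(v)-\mathrm{Val}_\pi(u)$ is positive; applying it yields the policy $\pi^{e}$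 that chooses $v$ in $u$ and agrees with $\pi$ elsewhere. Single-switch policy iteration starts with a weak unichain policy and repeatedly applies one improving switch to the current policy, until there is none. Dantzig's rule chooses an improving switch $e$ maximizing $z_\pi(e)$; Bland's rule, for a numbering of the agent edges by distinct numbers, chooses the improving switch of smallest number; the Largest Increase rule chooses an improving switch $e$ maximizing $\sum_{v\in V_A}\mathrm{Val}_{\pi^{e}}(v)$. **Theorem.** There are a family $(\mathcal D_n)_{n\in\mathbb N}$ of Markov decision processes of size $O(n)$, initial policies $\pi_n$ for $\mathcal D_n$, and numberings $\mathcal N_n$ of the agent edges of $\mathcal D_n$ such that, started in $\pi_n$, single-switch policy iteration on $\mathcal D_n$ visits only weak unichain policies (whatever improving switches are chosen; in particular $\pi_n$ is weak unichain), and performs $\Omega(2^n)$ improving switches with each of the following three pivot rules, however ties are broken: Dantzig's rule, Bland's rule with the numbering $\mathcal N_n$, and the Largest Increase rule. -/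

import Mathlib

open Filter Topology Asymptotics

/-- A finite Markov decision process. The vertices are the agent vertices together with the
randomization vertices, and the directed edges are given by the sets of out-neighbours. The values
of `reward` and `prob` on pairs that are not edges are irrelevant. -/
structure MDP where
  Agent : Type
  Rand : Type
  [fintypeAgent : Fintype Agent]
  [fintypeRand : Fintype Rand]
  [decEqAgent : DecidableEq Agent]
  [decEqRand : DecidableEq Rand]
  /-- out-neighbours of an agent vertex -/
  agentOut : Agent → Finset (Agent ⊕ Rand)
  /-- out-neighbours of a randomization vertex -/
  randOut : Rand → Finset (Agent ⊕ Rand)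
  reward : Agent → Agent ⊕ Rand → ℝ
  prob : Rand → Agent ⊕ Rand → ℝ
  agentOut_nonempty : ∀ u, (agentOut u).Nonempty
  randOut_nonempty : ∀ u, (randOut u).Nonempty
  prob_mem : ∀ u, ∀ v ∈ randOut u, prob u v ∈ Set.Icc (0 : ℝ) 1
  prob_sum : ∀ u, ∑ v ∈ randOut u, prob u v = 1

namespace MDP

attribute [instance] fintypeAgent fintypeRand decEqAgent decEqRand

variable (G : MDP)

/-- All vertices of the process. -/
abbrev Vertex : Type := G.Agent ⊕ G.Rand

/-- The out-neighbours of a vertex. -/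
def out : G.Vertex → Finset G.Vertex
  | .inl u => G.agentOut u
  | .inr u => G.randOut u

/-- The size of the process: the number of its vertices plus the number of its edges. -/
def size : ℕ := Fintype.card G.Vertex + ∑ v : G.Vertex, (G.out v).card

/-- The agent edges. -/
abbrev AgentEdge : Type := {e : G.Agent × G.Vertex // e.2 ∈ G.agentOut e.1}

/-- A sink: an agent vertex whose only outgoing edge is a self-loop of reward zero and which can be
reached from every vertex along edges. -/
def IsSink (s : G.Agent) : Prop :=
  G.agentOut s = {Sum.inl s} ∧ G.reward s (Sum.inl s) = 0 ∧
    ∀ v : G.Vertex, Relation.ReflTransGen (fun x y => y ∈ G.out x) v (Sum.inl s)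

/-- A policy chooses an outgoing edge in every agent vertex. -/
abbrev Policy : Type := {π : G.Agent → G.Vertex // ∀ u, π u ∈ G.agentOut u}

variable {G}

/-- One-step transition probabilities of the process when the agent follows `π`. -/
def transition (π : G.Policy) : Matrix G.Vertex G.Vertex ℝ := fun u v =>
  match u with
  | .inl a => if v = π.1 a then 1 else 0
  | .inr x => if v ∈ G.randOut x then G.prob x v else 0

/-- `π` is weak unichain: from every starting vertex it reaches the sink with probability one.
Since the process never leaves a sink, the probability of having reached the sink within `k` steps
is the probability of being there after exactly `k` steps. -/
def WeakUnichain (π : G.Policy) : Prop :=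
  ∃ s : G.Agent, G.IsSink s ∧
    ∀ v : G.Vertex, Tendsto (fun k : ℕ => (transition π ^ k) v (Sum.inl s)) atTop (𝓝 1)

/-- The Bellman equations for `π`, with the normalization that the sink (if any) has value zero. -/
def IsValue (π : G.Policy) (val : G.Vertex → ℝ) : Prop :=
  (∀ u : G.Agent, val (Sum.inl u) = G.reward u (π.1 u) + val (π.1 u)) ∧
  (∀ u : G.Rand, val (Sum.inr u) = ∑ v ∈ G.randOut u, G.prob u v * val v) ∧
  ∀ s : G.Agent, G.IsSink s → val (Sum.inl s) = 0

open Classical in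
/-- The value function of `π`: the solution of its Bellman system, which exists and is unique if `π`
is weak unichain (and `0` by convention if the system does not have exactly one solution). -/
noncomputable def value (π : G.Policy) : G.Vertex → ℝ :=
  if h : ∃! val : G.Vertex → ℝ, IsValue π val then h.choose else 0

/-- The reduced costs of an agent edge with respect to `π`. -/
noncomputable def reducedCost (π : G.Policy) (e : G.AgentEdge) : ℝ :=
  G.reward e.1.1 e.1.2 + value π e.1.2 - value π (Sum.inl e.1.1)

/-- The agent edge `e` is an improving switch for `π`. -/
def IsImproving (π : G.Policy) (e : G.AgentEdge) : Prop := 0 < reducedCost π e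

/-- The policy that results from applying the switch `e` to `π`. -/
def applySwitch (π : G.Policy) (e : G.AgentEdge) : G.Policy :=
  ⟨Function.update π.1 e.1.1 e.1.2, by
    intro u
    by_cases h : u = e.1.1
    · subst h
      simpa using e.2
    · simpa [Function.update_of_ne h] using π.2 u⟩

variable (G) in
/-- A pivot rule: `R π e` says that the rule allows to apply the switch `e` to `π`. Several choices
may be allowed (ties). -/
abbrev PivotRule : Type := G.Policy → G.AgentEdge → Prop

/-- Bland's rule for a numbering of the agent edges: the improving switch of smallest number. -/
def blandRule (num : G.AgentEdge → ℕ) : G.PivotRule := fun π e =>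
  IsImproving π e ∧ ∀ e', IsImproving π e' → num e ≤ num e'

/-- Dantzig's rule: an improving switch of maximum reduced costs. -/
def dantzigRule : G.PivotRule := fun π e =>
  IsImproving π e ∧ ∀ e', IsImproving π e' → reducedCost π e' ≤ reducedCost π e

/-- The Largest Increase rule: an improving switch that maximizes the sum of the values of the agent
vertices with respect to the resulting policy. -/
def largestIncreaseRule : G.PivotRule := fun π e =>
  IsImproving π e ∧ ∀ e', IsImproving π e' →
    ∑ v : G.Agent, value (applySwitch π e') (Sum.inl v) ≤
      ∑ v : G.Agent, value (applySwitch π e) (Sum.inl v)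

/-- `Runs R π₀ k π`: applying `k` switches, each of them allowed by `R` for the then current policy,
single-switch policy iteration can get from `π₀` to `π`. -/
inductive Runs (R : G.PivotRule) (π₀ : G.Policy) : ℕ → G.Policy → Prop
  | start : Runs R π₀ 0 π₀
  | step {k : ℕ} {π : G.Policy} (e : G.AgentEdge) (hrun : Runs R π₀ k π) (he : R π e) :
      Runs R π₀ (k + 1) (applySwitch π e)

/-- Started in `π₀`, policy iteration with the rule `R` performs at least `N` improving switches,
however ties are broken: after fewer than `N` switches it never stops. -/
def PerformsAtLeast (R : G.PivotRule) (π₀ : G.Policy) (N : ℕ) : Prop :=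
  ∀ k < N, ∀ π, Runs R π₀ k π → ∃ e, R π e

end MDP

/-!
The process is a binary counter. Its `n` levels are numbered from the most significant one, level
`0`, downwards. Level `k` has two targets, called `false` and `true`, whose values differ by
`gap p s k`, and four agent vertices, called cells. In each cell the agent chooses a target `c`; the
agent then gets there with a small probability `p k`, and otherwise moves on to another cell of the
level, the mate of the cell with respect to `c`. The targets of level `0` have the values `0` and
`1`. The targets of level `k + 1` are a fixed cell of level `k`, and a vertex whose value is the
average over the two targets of level `k`. So, if the cells of level `k` get the value of the worse
target, then the fixed cell is below the average, and `true` is the better target of level `k + 1`;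
if they get the value of the better target, it is `false`. Hence, whenever level `k` moves to its
better target, the better targets of all levels after it are interchanged (as in a Gray code). If
all these levels are at their better targets at this time, they are all at the worse ones
afterwards. This is the carry of a counter whose digit `1` stands for a level at its better target.

It remains to make the pivot rules serve the last level first. With a single cell per level this
would be automatic for Bland's rule, and for Dantzig's rule if `p k` grows quickly with `k`, as the
reduced costs in level `k` are of order `p k`. For the Largest Increase rule it is the reason for
having four cells. Two cells that are mates with respect to their common choice `c` trap the walk,
so that it leaves the level at `c`. If all choices are equal, there are two disjoint traps, and so a
single switch (it arms the level) destroys only one of them and changes the values by a multiple of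
`p k` only. The next switch, of the mate of the first cell, creates a trap for the other target, and
it fires the level with a large gain; the remaining two cells follow by switches that have a small
effect again. Level `k` is armed only if no later level has an improving switch, so that firing it
never competes with them. All other switches in level `k` have a reduced cost and an effect on the
values between `p k ^ 2` and `p k`, up to factors bounded in terms of `n`. Thus all three rules
follow the counter if `p k` is much smaller than `p (k + 1) ^ 2`.

The combinatorial part is `Move.inv`: moves, of which the definition captures what the three rules
have in common, increase the counter by at most one. That the rules perform only moves is shown in
`dantzig_move`, `bland_move` and `largestIncrease_move`; `performsAtLeast_of_move` concludes. The
values are computed explicitly (`value_process`), and they are unique by the maximum principle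
(`MDP.Reaches.eq_of_harmonic`), which also shows that all policies are weak unichain.
-/

/-! ### A single level -/

namespace BinaryCounter

/-- The four agent vertices of a level. -/
abbrev Cell : Type := Bool × Bool

/-- The vertex of the same level to which the choice `c` leads back. -/
def mate (c : Bool) (x : Cell) : Cell := if c then (!x.1, x.2) else (x.1, !x.2)

/-- `c` as a real number. -/
def bit (c : Bool) : ℝ := if c then 1 else 0

/-- The sign `1` for `true`, `-1` for `false`. -/
def sgn (d : Bool) : ℝ := if d then 1 else -1

/-- The probability that the walk starting in the cell `x` leaves the level through its target
`true`, if the agent makes the choices `s` and each choice `c` leads to the target `c` with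
probability `p` and to `mate c _` otherwise. The walk is deterministic until it leaves; it ends up
in a cycle of two mates with the same choice or, in the last case, in a cycle of all four cells;
`escape` is the probability to leave through the target other than `s x`. -/
noncomputable def share (p : ℝ) (s : Cell → Bool) (x : Cell) : ℝ :=
  let c := s x
  let y := mate c x
  let z := mate (!c) y
  let escape : ℝ :=
    if s y = c then 0
    else if s z = !c then 1 - p
    else if s (mate c z) = c then (1 - p) * p
    else (1 - p) / (2 - p)
  if c then 1 - escape else escape

/-- The gain in the exit probability through the target `true` from making the other choice once in
`x`, and following `s` afterwards. -/
noncomputable def advantage (p : ℝ) (s : Cell → Bool) (x : Cell) : ℝ :=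
  p * bit (!s x) + (1 - p) * share p s (mate (!s x) x) - share p s x

/-- Reverse the choice in `x`. -/
def toggle (s : Cell → Bool) (x : Cell) : Cell → Bool := Function.update s x (!s x)

/-- Some cell and its `d`-mate both make the choice `d`. The walk then stays among these two until
it leaves through the target `d`, and so from every cell it leaves through `d` with high
probability. -/
def Trapped (d : Bool) (s : Cell → Bool) : Prop := ∃ x, s x = d ∧ s (mate d x) = d

instance (d : Bool) (s : Cell → Bool) : Decidable (Trapped d s) := by
  unfold Trapped; infer_instance

/-- The choices of the four cells, listed. -/
def state (a b c d : Bool) : Cell → Bool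
  | (false, false) => a
  | (false, true) => b
  | (true, false) => c
  | (true, true) => d

lemma forall_state {P : (Cell → Bool) → Prop} (h : ∀ a b c d, P (state a b c d)) (s) : P s := by
  have : s = state (s (false, false)) (s (false, true)) (s (true, false)) (s (true, true)) := by
    funext ⟨i, j⟩
    cases i <;> cases j <;> rfl
  rw [this]
  exact h _ _ _ _

lemma forall_cell {P : Cell → Prop} (h1 : P (false, false)) (h2 : P (false, true))
    (h3 : P (true, false)) (h4 : P (true, true)) (x) : P x := by
  obtain ⟨i, j⟩ := x
  cases i <;> cases j <;> assumption

/-- The defining equations of an exit probability. -/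
lemma share_eq {p : ℝ} (hp0 : 0 < p) (hp : p ≤ 1 / 4) (s : Cell → Bool) (x : Cell) :
    share p s x = p * bit (s x) + (1 - p) * share p s (mate (s x) x) := by
  have h2 : 2 - p ≠ 0 := by linarith
  revert x
  induction s using forall_state with
  | h a b c d =>
  refine forall_cell ?_ ?_ ?_ ?_ <;> cases a <;> cases b <;> cases c <;> cases d <;>
    simp [share, mate, state, bit] <;> first | done | (field_simp; done) | (field_simp; ring)

section Level

variable {p : ℝ} {s : Cell → Bool} {d : Bool} {x y : Cell}

lemma share_const (d : Bool) (x : Cell) : share p (fun _ => d) x = bit d := by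
  cases d <;> simp [share, bit]

lemma mate_ne (c : Bool) (x : Cell) : mate c x ≠ x := by
  obtain ⟨i, j⟩ := x
  cases c <;> simp [mate]

lemma toggle_of_ne (h : y ≠ x) : toggle s x y = s y := Function.update_of_ne h _ _

lemma toggle_self : toggle s x x = !s x := Function.update_self _ _ _

lemma trapped_const (d : Bool) : Trapped d (fun _ => d) := ⟨(false, false), rfl, rfl⟩

lemma mate_mate (c : Bool) (x : Cell) : mate c (mate c x) = x := by
  cases c <;> simp [mate]

lemma trapped_toggle_mate (d : Bool) (y : Cell) :
    Trapped d (toggle (toggle (fun _ => !d) y) (mate d y)) := by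
  refine ⟨y, ?_, ?_⟩
  · rw [toggle_of_ne (mate_ne d y).symm, toggle_self]; simp
  · rw [toggle_self, toggle_of_ne (mate_ne d y)]; simp

lemma share_near_of_trapped (hp0 : 0 < p) (hp : p ≤ 1 / 4) (h : Trapped d s) (x : Cell) :
    0 ≤ sgn d * (bit d - share p s x) ∧ sgn d * (bit d - share p s x) ≤ p := by
  revert h
  revert x
  induction s using forall_state with
  | h a b c e =>
  refine forall_cell ?_ ?_ ?_ ?_ <;> cases a <;> cases b <;> cases c <;> cases e <;> cases d <;>
    simp [share, mate, state, bit, sgn, Trapped] <;>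
    first | done | nlinarith | (constructor <;> nlinarith)

lemma share_near_of_armed (hp0 : 0 < p) (hp : p ≤ 1 / 4) (d : Bool) (y x : Cell) :
    0 ≤ sgn d * (share p (toggle (fun _ => !d) y) x - bit (!d)) ∧
      sgn d * (share p (toggle (fun _ => !d) y) x - bit (!d)) ≤ p := by
  revert x y
  refine forall_cell ?_ ?_ ?_ ?_ <;> refine forall_cell ?_ ?_ ?_ ?_ <;> cases d <;>
    simp [share, mate, toggle, bit, sgn, Function.update] <;>
    first | done | nlinarith | (constructor <;> nlinarith)

/-- If all shares of a level lie within `p` of each other, then switching `x` towards `d` has an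
advantage of at least `p ^ 2`. -/
lemma sq_le_advantage (hp0 : 0 < p) (hp : p ≤ 1 / 4)
    (hosc : ∀ x y, share p s x - share p s y ≤ p) (hx : s x = !d) :
    p ^ 2 ≤ sgn d * advantage p s x := by
  have h1 := share_eq hp0 hp s x
  have h2 := hosc (mate true x) (mate false x)
  have h3 := hosc (mate false x) (mate true x)
  unfold advantage
  rw [h1, hx]
  cases d <;> simp [sgn, bit] <;> nlinarith

/-- If all shares of a level lie within `p` of each other, then switching `x` away from `d` has a
negative advantage. -/
lemma advantage_neg (hp0 : 0 < p) (hp : p ≤ 1 / 4)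
    (hosc : ∀ x y, share p s x - share p s y ≤ p) (hx : s x = d) :
    sgn d * advantage p s x < 0 := by
  have h := sq_le_advantage (d := !d) hp0 hp hosc (by simpa using hx)
  have : sgn (!d) = - sgn d := by cases d <;> simp [sgn]
  rw [this] at h
  nlinarith

/-- A toggle with positive advantage increases all shares, by at least the advantage at the toggled
vertex: the difference `w` satisfies `w y = (1 - p) * w (mate _ y)` up to the nonnegative advantage,
so that its minimum cannot be negative. -/
lemma share_toggle (hp0 : 0 < p) (hp : p ≤ 1 / 4) (hx : 0 < sgn d * advantage p s x) :
    (∀ y, sgn d * share p s y ≤ sgn d * share p (toggle s x) y) ∧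
      sgn d * share p s x + sgn d * advantage p s x ≤ sgn d * share p (toggle s x) x := by
  set w : Cell → ℝ := fun y => sgn d * share p (toggle s x) y - sgn d * share p s y with hw
  have hwx : w x = sgn d * advantage p s x + (1 - p) * w (mate (!s x) x) := by
    have := share_eq hp0 hp (toggle s x) x
    rw [toggle_self] at this
    simp only [hw, advantage]
    rw [this]
    ring
  have hwy : ∀ y, y ≠ x → w y = (1 - p) * w (mate (s y) y) := by
    intro y hy
    have h1 := share_eq hp0 hp (toggle s x) y
    have h2 := share_eq hp0 hp s y
    rw [toggle_of_ne hy] at h1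
    simp only [hw]
    rw [h1, h2]
    ring
  obtain ⟨y, hy⟩ := Finite.exists_min w
  have hy0 : 0 ≤ w y := by
    by_cases hyx : y = x
    · subst hyx
      have := hy (mate (!s y) y)
      nlinarith
    · have := hy (mate (s y) y)
      have := hwy y hyx
      nlinarith
  have hpos : ∀ z, 0 ≤ w z := fun z => hy0.trans (hy z)
  refine ⟨fun z => by linarith [hpos z, show w z = _ from rfl], ?_⟩
  have := hpos (mate (!s x) x)
  have : w x = sgn d * share p (toggle s x) x - sgn d * share p s x := rfl
  nlinarith

/-- If an armed level, with only `y` set to `d`, toggles a vertex other than `y` and its mate, then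
all shares stay away from the target `d`. -/
lemma armed_toggle_other (hp0 : 0 < p) (hp : p ≤ 1 / 4) (hy : x ≠ y) (hm : x ≠ mate d y)
    (z : Cell) : p ≤ sgn d * (bit d - share p (toggle (toggle (fun _ => !d) y) x) z) := by
  have h2 : 0 < 2 - p := by linarith
  obtain ⟨r, hr⟩ : ∃ r, r = (1 - p) / (2 - p) := ⟨_, rfl⟩
  have h5 : r * (2 - p) = 1 - p := by rw [hr]; field_simp
  have h7 : r ≤ 1 - p := by nlinarith
  have h8 : p ≤ r := by nlinarith
  have h9 : 0 ≤ p * p := by positivity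
  clear h2 h5
  revert hy hm
  obtain ⟨i, j⟩ := x
  obtain ⟨k, l⟩ := y
  obtain ⟨m, n⟩ := z
  cases d <;> cases i <;> cases j <;> cases k <;> cases l <;> cases m <;> cases n <;>
    simp [share, mate, sgn, toggle, Function.update, bit, ← hr] <;> linarith

/-- In an armed level, with only `y` set to `d`, toggling the mate of `y` leads to larger shares
than any other toggle. -/
lemma armed_toggle_lt (hp0 : 0 < p) (hp : p ≤ 1 / 4) (hy : x ≠ y) (hm : x ≠ mate d y) :
    (∀ z, sgn d * share p (toggle (toggle (fun _ => !d) y) x) z ≤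
        sgn d * share p (toggle (toggle (fun _ => !d) y) (mate d y)) z) ∧
      sgn d * share p (toggle (toggle (fun _ => !d) y) x) (mate d y) <
        sgn d * share p (toggle (toggle (fun _ => !d) y) (mate d y)) (mate d y) := by
  have ht := trapped_toggle_mate d y
  constructor
  · intro z
    have := armed_toggle_other hp0 hp hy hm z
    have := (share_near_of_trapped hp0 hp ht z).2
    linarith
  · have h1 := armed_toggle_other hp0 hp hy hm (mate d y)
    have h2 : share p (toggle (toggle (fun _ => !d) y) (mate d y)) (mate d y) = bit d := by
      have h3 : toggle (toggle (fun _ => !d) y) (mate d y) (mate d y) = d := by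
        rw [toggle_self, toggle_of_ne (mate_ne d y)]; simp
      have h4 : toggle (toggle (fun _ => !d) y) (mate d y) y = d := by
        rw [toggle_of_ne (mate_ne d y).symm, toggle_self]; simp
      simp only [share, h3, mate_mate, h4]
      cases d <;> simp [bit]
    rw [h2]
    linarith

/-- In an armed level, toggling the mate of `y` has a larger advantage than any other toggle. -/
lemma armed_advantage_lt (hp0 : 0 < p) (hp : p ≤ 1 / 4) (hy : x ≠ y) (hm : x ≠ mate d y) :
    sgn d * advantage p (toggle (fun _ => !d) y) x <
      sgn d * advantage p (toggle (fun _ => !d) y) (mate d y) := by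
  have h1 : 0 < (1 - p) * (p * p) := by apply mul_pos <;> nlinarith
  revert hy hm
  obtain ⟨i, j⟩ := x
  obtain ⟨k, l⟩ := y
  cases i <;> cases j <;> cases k <;> cases l <;> cases d <;>
    simp [share, advantage, bit, mate, sgn, toggle, Function.update] <;> nlinarith

end Level

/-! ### The binary counter -/

section Levels

variable {p : ℕ → ℝ} {s s' : ℕ → Cell → Bool} {A : Cell → Prop} {t : Cell → Bool} {d : Bool}
  {n k j : ℕ} {x y : Cell}

/-- The value of the target `true` of level `k` minus the value of its target `false`, for the
choices `s`. The target `true` of level `k + 1` has the average value of the targets of level `k`,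
and its target `false` is the cell `(false, false)` of level `k`. -/
noncomputable def gap (p : ℕ → ℝ) (s : ℕ → Cell → Bool) : ℕ → ℝ
  | 0 => 1
  | k + 1 => (1 / 2 - share (p k) (s k) (false, false)) * gap p s k

/-- The value of the target `false` of level `k`. -/
noncomputable def low (p : ℕ → ℝ) (s : ℕ → Cell → Bool) : ℕ → ℝ
  | 0 => 0
  | k + 1 => low p s k + share (p k) (s k) (false, false) * gap p s k

/-- The target of level `k` with the larger value, that is, the sign of `gap p s k` (see
`gap_bounds`). -/
def desired (s : ℕ → Cell → Bool) : ℕ → Bool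
  | 0 => true
  | k + 1 => !decide (Trapped (desired s k) (s k))

/-- The binary number with the digits `1` in the levels that are trapped at their desired target,
the uppermost level `0` being the most significant one; only the levels with index less than `k` are
counted. -/
def counter (s : ℕ → Cell → Bool) : ℕ → ℕ
  | 0 => 0
  | k + 1 => 2 * counter s k + if Trapped (desired s k) (s k) then 1 else 0

/-- The states of a level that occur: idle (all choices are undesired), armed (exactly one choice,
in a cell allowed by `A`, is desired), and trapped at the desired target `d`. -/
def Good (A : Cell → Prop) (d : Bool) (t : Cell → Bool) : Prop :=
  (t = fun _ => !d) ∨ (∃ y, A y ∧ t = toggle (fun _ => !d) y) ∨ Trapped d t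

lemma not_trapped_idle (d : Bool) : ¬ Trapped d (fun _ => !d) := by
  rintro ⟨x, hx, -⟩
  simp at hx

lemma not_trapped_armed (d : Bool) (y : Cell) : ¬ Trapped d (toggle (fun _ => !d) y) := by
  rintro ⟨x, hx, hm⟩
  have key : ∀ z, toggle (fun _ => !d) y z = d → z = y := by
    intro z hz
    by_contra h
    rw [toggle_of_ne h] at hz
    simp at hz
  exact mate_ne d x ((key _ hm).trans (key _ hx).symm)

lemma trapped_toggle (h : Trapped d t) (hx : t x = !d) : Trapped d (toggle t x) := by
  obtain ⟨y, hy, hm⟩ := h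
  refine ⟨y, ?_, ?_⟩
  · rw [toggle_of_ne, hy]
    rintro rfl
    simp [hy] at hx
  · rw [toggle_of_ne, hm]
    rintro rfl
    simp [hm] at hx

lemma share_near_of_not_trapped {p : ℝ} (hp0 : 0 < p) (hp : p ≤ 1 / 4) (h : Good A d t)
    (ht : ¬ Trapped d t) (x : Cell) :
    0 ≤ sgn d * (share p t x - bit (!d)) ∧ sgn d * (share p t x - bit (!d)) ≤ p := by
  rcases h with rfl | ⟨y, -, rfl⟩ | h
  · simp [share_const, hp0.le]
  · exact share_near_of_armed hp0 hp d y x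
  · exact absurd h ht

lemma sub_share_le {p : ℝ} (hp0 : 0 < p) (hp : p ≤ 1 / 4) (h : Good A d t) (x y : Cell) :
    share p t x - share p t y ≤ p := by
  by_cases ht : Trapped d t
  · have h1 := share_near_of_trapped hp0 hp ht x
    have h2 := share_near_of_trapped hp0 hp ht y
    cases d <;> simp [sgn] at h1 h2 <;> linarith
  · have h1 := share_near_of_not_trapped hp0 hp h ht x
    have h2 := share_near_of_not_trapped hp0 hp h ht y
    cases d <;> simp [sgn] at h1 h2 <;> linarith

/-- In a good level, the improving switches are exactly those towards the desired target. -/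
lemma advantage_pos_iff {p : ℝ} (hp0 : 0 < p) (hp : p ≤ 1 / 4) (h : Good A d t) :
    0 < sgn d * advantage p t x ↔ t x = !d := by
  constructor
  · intro hx
    by_contra hne
    have : t x = d := by cases d <;> simpa using hne
    exact absurd hx (advantage_neg hp0 hp (sub_share_le hp0 hp h) this).le.not_gt
  · intro hx
    exact lt_of_lt_of_le (by positivity) (sq_le_advantage hp0 hp (sub_share_le hp0 hp h) hx)

/-- Toggling a vertex of a level that is not armed changes all shares by at most `p`. -/
lemma share_toggle_le {p : ℝ} (hp0 : 0 < p) (hp : p ≤ 1 / 4)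
    (h : (t = fun _ => !d) ∨ Trapped d t) (hx : t x = !d) (y : Cell) :
    sgn d * share p (toggle t x) y ≤ sgn d * share p t y + p := by
  rcases h with rfl | h
  · have := (share_near_of_armed hp0 hp d x y).2
    rw [share_const]
    linarith
  · have h1 := share_near_of_trapped hp0 hp h y
    have h2 := share_near_of_trapped hp0 hp (trapped_toggle h hx) y
    linarith

/-- The gap shrinks by a factor between `1 / 4` and `1` from each level to the next, as all shares
are close to `0` or `1`, and its sign is the one recorded in `desired`. -/
lemma gap_bounds (hp0 : ∀ k, 0 < p k) (hp : ∀ k, p k ≤ 1 / 4)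
    (h : ∀ j < k, Good A (desired s j) (s j)) :
    (1 / 4 : ℝ) ^ k ≤ sgn (desired s k) * gap p s k ∧ sgn (desired s k) * gap p s k ≤ 1 := by
  induction k with
  | zero => simp [gap, desired, sgn]
  | succ k ih =>
    obtain ⟨h1, h2⟩ := ih fun j hj => h j (hj.trans k.lt_succ_self)
    have hpos : (0 : ℝ) < (1 / 4) ^ k := by positivity
    have hpk := hp k
    -- the sign of the gap is passed on, reversed if the level is trapped
    obtain ⟨c, hc1, hc2, hc⟩ : ∃ c : ℝ, 1 / 4 ≤ c ∧ c ≤ 1 ∧ sgn (desired s (k + 1)) *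
        (1 / 2 - share (p k) (s k) (false, false)) = c * sgn (desired s k) := by
      by_cases ht : Trapped (desired s k) (s k)
      · have h3 := share_near_of_trapped (hp0 k) (hp k) ht (false, false)
        rw [desired, decide_eq_true ht]
        revert h3
        cases desired s k <;> simp only [sgn, bit] <;> simp <;> intro h3 h4
        · exact ⟨1 / 2 - share (p k) (s k) (false, false), by linarith, by linarith, by ring⟩
        · constructor <;> linarith
      · have h3 := share_near_of_not_trapped (hp0 k) (hp k) (h k k.lt_succ_self) ht (false, false)
        rw [desired, decide_eq_false ht]
        revert h3
        cases desired s k <;> simp only [sgn, bit] <;> simp <;> intro h3 h4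
        · exact ⟨share (p k) (s k) (false, false) - 1 / 2, by linarith, by linarith, by ring⟩
        · constructor <;> linarith
    rw [gap, ← mul_assoc, hc, mul_assoc, pow_succ]
    constructor <;> nlinarith

/-- Reverse the choice in the cell `x` of level `k`. -/
def flip (s : ℕ → Cell → Bool) (k : ℕ) (x : Cell) : ℕ → Cell → Bool :=
  Function.update s k (toggle (s k) x)

lemma flip_self : flip s k x k = toggle (s k) x := Function.update_self _ _ _

lemma flip_of_ne (h : j ≠ k) : flip s k x j = s j := Function.update_of_ne h _ _

lemma desired_congr (h : ∀ i < j, s' i = s i) : desired s' j = desired s j := by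
  induction j with
  | zero => rfl
  | succ j ih =>
    simp only [desired, ih fun i hi => h i (hi.trans j.lt_succ_self), h j j.lt_succ_self]

lemma counter_congr (h : ∀ i < j, s' i = s i) : counter s' j = counter s j := by
  induction j with
  | zero => rfl
  | succ j ih =>
    simp only [counter, ih fun i hi => h i (hi.trans j.lt_succ_self), h j j.lt_succ_self,
      desired_congr fun i hi => h i (hi.trans j.lt_succ_self)]

lemma desired_flip_of_le (h : j ≤ k) : desired (flip s k x) j = desired s j :=
  desired_congr fun _ hi => flip_of_ne (by omega)

lemma counter_flip_of_le (h : j ≤ k) : counter (flip s k x) j = counter s j :=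
  counter_congr fun _ hi => flip_of_ne (by omega)

/-- A toggle that does not change whether its level is trapped affects neither the desired choices
nor the counter. -/
lemma desired_counter_flip
    (h : Trapped (desired s k) (toggle (s k) x) ↔ Trapped (desired s k) (s k)) (j : ℕ) :
    desired (flip s k x) j = desired s j ∧ counter (flip s k x) j = counter s j := by
  induction j with
  | zero => exact ⟨rfl, rfl⟩
  | succ j ih =>
    by_cases hj : j = k
    · subst hj
      simp only [desired, counter, ih.1, ih.2, flip_self, h, and_self]
    · simp only [desired, counter, ih.1, ih.2, flip_of_ne hj, and_self]

/-- The invariant of policy iteration: all levels are good, and if a level is armed, all choices in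
the levels of larger index are as desired. -/
structure Inv (A : Cell → Prop) (n : ℕ) (s : ℕ → Cell → Bool) : Prop where
  good : ∀ k < n, Good A (desired s k) (s k)
  armed : ∀ k < n, ∀ y, s k = toggle (fun _ => !desired s k) y →
    ∀ j, k < j → j < n → s j = fun _ => desired s j

/-- The switches that advance the counter: an improving switch in the last level that has one, such
that an idle level is armed in a cell allowed by `A`, and an armed level fires, that is, toggles the
mate of its desired cell. -/
structure Move (A : Cell → Prop) (n : ℕ) (s : ℕ → Cell → Bool) (k : ℕ) (x : Cell) : Prop where
  lt : k < n
  ne : s k x = !desired s k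
  below : ∀ j, k < j → j < n → s j = fun _ => desired s j
  arm : (s k = fun _ => !desired s k) → A x
  fire : ∀ y, s k = toggle (fun _ => !desired s k) y → x = mate (desired s k) y

lemma Move.not_armed_of_lt (hI : Inv A n s) (hm : Move A n s k x) (hj : j < k) (y : Cell) :
    s j ≠ toggle (fun _ => !desired s j) y := by
  intro h
  have := hI.armed j (hj.trans hm.lt) y h k hj hm.lt
  have h2 := hm.ne
  rw [this] at h2
  simp at h2

lemma Move.inv_of_iff (hI : Inv A n s) (hm : Move A n s k x)
    (h : Trapped (desired s k) (toggle (s k) x) ↔ Trapped (desired s k) (s k))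
    (hg : Good A (desired s k) (toggle (s k) x)) : Inv A n (flip s k x) := by
  have hd := fun j => (desired_counter_flip h j).1
  constructor
  · intro j hj
    rw [hd]
    by_cases hjk : j = k
    · subst hjk
      rwa [flip_self]
    · rw [flip_of_ne hjk]
      exact hI.good j hj
  · intro j hj y hy i hji hi
    rw [hd] at hy
    have hjk : k ≤ j := by
      by_contra! hlt
      rw [flip_of_ne hlt.ne] at hy
      exact hm.not_armed_of_lt hI hlt y hy
    rw [hd, flip_of_ne (by omega)]
    exact hm.below i (by omega) hi

/-- After the armed level `k` has fired, all levels of larger index are idle: there the desired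
choices are reversed, and the carry propagates through the counter. -/
lemma Move.desired_counter_fire (hm : Move A n s k x) (h : ¬ Trapped (desired s k) (s k))
    (h' : Trapped (desired s k) (toggle (s k) x)) (hkj : k < j) (hj : j ≤ n) :
    desired (flip s k x) j = !desired s j ∧ counter (flip s k x) j = counter s j + 1 := by
  induction j, hkj using Nat.le_induction with
  | base =>
    simp only [desired, counter, desired_flip_of_le le_rfl,
      counter_flip_of_le le_rfl, flip_self, h, h']
    simp
  | succ j hkj ih =>
    obtain ⟨h1, h2⟩ := ih (by omega)
    have h3 := hm.below j hkj (by omega)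
    have h4 : ¬ Trapped (!desired s j) (s j) := by
      rw [h3]; simpa using not_trapped_idle (!desired s j)
    have h5 : Trapped (desired s j) (s j) := by
      conv => arg 2; rw [h3]
      exact trapped_const _
    have hne : j ≠ k := by omega
    constructor
    · simp only [desired, flip_of_ne hne, h1, h4, h5]
      simp
    · simp only [counter, flip_of_ne hne, h1, h4, h5, h2]
      simp
      omega

lemma Move.inv_of_fire (hI : Inv A n s) (hm : Move A n s k x) (h : ¬ Trapped (desired s k) (s k))
    (h' : Trapped (desired s k) (toggle (s k) x)) : Inv A n (flip s k x) := by
  have hd := fun j h1 h2 => (hm.desired_counter_fire h h' (j := j) h1 h2).1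
  constructor
  · intro j hj
    rcases lt_trichotomy j k with hjk | rfl | hjk
    · rw [desired_flip_of_le hjk.le, flip_of_ne hjk.ne]
      exact hI.good j hj
    · rw [desired_flip_of_le le_rfl, flip_self]
      exact Or.inr (Or.inr h')
    · rw [hd j hjk hj.le, flip_of_ne hjk.ne']
      left
      rw [Bool.not_not]
      exact hm.below j hjk hj
  · intro j hj y hy
    exfalso
    rcases lt_trichotomy j k with hjk | rfl | hjk
    · rw [desired_flip_of_le hjk.le, flip_of_ne hjk.ne] at hy
      exact hm.not_armed_of_lt hI hjk y hy
    · rw [desired_flip_of_le le_rfl, flip_self] at hy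
      rw [hy] at h'
      exact not_trapped_armed _ _ h'
    · rw [hd j hjk hj.le, flip_of_ne hjk.ne', hm.below j hjk hj] at hy
      have := congrFun hy y
      simp [toggle_self] at this

/-- A move preserves the invariant, and it increases the counter by at most one. -/
theorem Move.inv (hI : Inv A n s) (hm : Move A n s k x) :
    Inv A n (flip s k x) ∧ counter (flip s k x) n ≤ counter s n + 1 := by
  rcases hI.good k hm.lt with h | ⟨y, -, h⟩ | h
  · have hiff : Trapped (desired s k) (toggle (s k) x) ↔ Trapped (desired s k) (s k) := by
      rw [h]
      exact iff_of_false (not_trapped_armed _ _) (not_trapped_idle _)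
    refine ⟨hm.inv_of_iff hI hiff ?_, by rw [(desired_counter_flip hiff n).2]; omega⟩
    exact Or.inr (Or.inl ⟨x, hm.arm h, congrArg (toggle · x) h⟩)
  · have h1 : ¬ Trapped (desired s k) (s k) := by
      rw [h]; exact not_trapped_armed _ _
    have h2 : Trapped (desired s k) (toggle (s k) x) := by
      rw [hm.fire y h, h]; exact trapped_toggle_mate _ _
    exact ⟨hm.inv_of_fire hI h1 h2, (hm.desired_counter_fire h1 h2 hm.lt le_rfl).2.le⟩
  · have h1 := trapped_toggle h hm.ne
    have hiff := iff_of_true h1 h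
    exact ⟨hm.inv_of_iff hI hiff (Or.inr (Or.inr h1)),
      by rw [(desired_counter_flip hiff n).2]; omega⟩

/-- Once all choices are as desired, the counter shows `2 ^ n - 1`. -/
lemma counter_of_const (h : ∀ j < n, s j = fun _ => desired s j) : counter s n + 1 = 2 ^ n := by
  induction n with
  | zero => rfl
  | succ n ih =>
    have h1 : Trapped (desired s n) (s n) := by
      conv => arg 2; rw [h n n.lt_succ_self]
      exact trapped_const _
    have := ih fun j hj => h j (hj.trans n.lt_succ_self)
    simp only [counter, h1, if_true, pow_succ]
    omega

lemma desired_counter_false (n : ℕ) :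
    desired (fun _ _ => false) n = true ∧ counter (fun _ _ => false) n = 0 := by
  induction n with
  | zero => exact ⟨rfl, rfl⟩
  | succ n ih =>
    have := not_trapped_idle true
    simp only [Bool.not_true] at this
    simp [desired, counter, ih, this]

lemma inv_false (A : Cell → Prop) (n : ℕ) : Inv A n (fun _ _ => false) := by
  have hd := fun n => (desired_counter_false n).1
  constructor
  · intro k _
    left
    simp [hd]
  · intro k _ y h
    have := congrFun h y
    simp [hd, toggle_self] at this

end Levels

/-! ### Values of the cells -/

section Values

variable {p : ℕ → ℝ} {s s' : ℕ → Cell → Bool} {k j : ℕ} {x y : Cell}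

lemma share_mem {p : ℝ} (hp0 : 0 < p) (hp : p ≤ 1 / 4) (s : Cell → Bool) (x : Cell) :
    0 ≤ share p s x ∧ share p s x ≤ 1 := by
  have hr : (1 - p) / (2 - p) ≤ 1 := by rw [div_le_one] <;> linarith
  have hr0 : 0 ≤ (1 - p) / (2 - p) := by apply div_nonneg <;> linarith
  have h1 : 0 ≤ (1 - p) * p := by nlinarith
  simp only [share]
  split_ifs <;> constructor <;> nlinarith

/-- The value of the cell `x` of level `k`, for the choices `s`. -/
noncomputable def cellValue (p : ℕ → ℝ) (s : ℕ → Cell → Bool) (k : ℕ) (x : Cell) : ℝ :=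
  low p s k + share (p k) (s k) x * gap p s k

lemma low_gap_congr (h : ∀ i < j, s' i = s i) :
    low p s' j = low p s j ∧ gap p s' j = gap p s j := by
  induction j with
  | zero => exact ⟨rfl, rfl⟩
  | succ j ih =>
    obtain ⟨h1, h2⟩ := ih fun i hi => h i (hi.trans j.lt_succ_self)
    simp only [low, gap, h1, h2, h j j.lt_succ_self, and_self]

/-- If the choices in level `k` change so that no value there decreases by more than `η`, then no
value at all does: the values of each level are convex combinations of those of its targets. -/
lemma cellValue_le_add (hp0 : ∀ k, 0 < p k) (hp : ∀ k, p k ≤ 1 / 4) {η : ℝ} (hη : 0 ≤ η)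
    (hs : ∀ j ≠ k, s' j = s j)
    (h : ∀ y, share (p k) (s k) y * gap p s k ≤ share (p k) (s' k) y * gap p s k + η) (j : ℕ)
    (x : Cell) : cellValue p s j x ≤ cellValue p s' j x + η := by
  have hle : ∀ j ≤ k, low p s' j = low p s j ∧ gap p s' j = gap p s j :=
    fun j hj => low_gap_congr fun i hi => hs i (by omega)
  have hlg : ∀ j, low p s j ≤ low p s' j + η ∧
      low p s j + gap p s j ≤ low p s' j + gap p s' j + η := by
    intro j
    rcases le_or_gt j k with hj | hj
    · obtain ⟨h1, h2⟩ := hle j hj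
      constructor <;> linarith
    · induction j, hj using Nat.le_induction with
      | base =>
        obtain ⟨h1, h2⟩ := hle k le_rfl
        have := h (false, false)
        simp only [low, gap, h1, h2]
        constructor <;> linarith
      | succ j hj ih =>
        obtain ⟨h1, h2⟩ := ih
        obtain ⟨h3, h4⟩ := share_mem (hp0 j) (hp j) (s j) (false, false)
        simp only [low, gap, hs j (by omega)]
        constructor <;> nlinarith
  by_cases hj : j = k
  · subst hj
    obtain ⟨h1, h2⟩ := hle j le_rfl
    have := h x
    simp only [cellValue, h1, h2]
    linarith
  · obtain ⟨h1, h2⟩ := hlg j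
    obtain ⟨h3, h4⟩ := share_mem (hp0 j) (hp j) (s j) x
    simp only [cellValue, hs j hj]
    nlinarith

end Values

end BinaryCounter

/-! ### Processes with a sink that every policy reaches -/

namespace MDP

variable {G : MDP}

lemma transition_nonneg (π : G.Policy) (u v : G.Vertex) : 0 ≤ transition π u v := by
  unfold transition
  rcases u with a | x
  · dsimp only; split_ifs <;> norm_num
  · dsimp only; split_ifs with h
    · exact (G.prob_mem x v h).1
    · exact le_rfl

lemma sum_transition_mul (π : G.Policy) (f : G.Vertex → ℝ) (u : G.Vertex) :
    ∑ v, transition π u v * f v = match u with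
      | .inl a => f (π.1 a)
      | .inr x => ∑ v ∈ G.randOut x, G.prob x v * f v := by
  rcases u with a | x
  · simp [transition]
  · simp only [transition, ite_mul, zero_mul]
    rw [← Finset.sum_filter]
    simp

lemma sum_transition (π : G.Policy) (u : G.Vertex) : ∑ v, transition π u v = 1 := by
  have := sum_transition_mul π (fun _ => 1) u
  simp only [mul_one] at this
  rw [this]
  rcases u with a | x
  · rfl
  · exact G.prob_sum x

/-- `v` is reached from every vertex with positive probability. -/
def Reaches (π : G.Policy) (v : G.Vertex) : Prop :=
  ∀ u, Relation.ReflTransGen (fun x y => 0 < transition π x y) u v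

/-- Maximum principle: a function that is harmonic for the Markov chain of `π` is constant if some
vertex is reached from everywhere. -/
lemma Reaches.eq_of_harmonic {π : G.Policy} {t : G.Vertex} (h : Reaches π t) {f : G.Vertex → ℝ}
    (hf : ∀ u, f u = ∑ v, transition π u v * f v) (u : G.Vertex) : f u = f t := by
  have key : ∀ f : G.Vertex → ℝ, (∀ u, f u = ∑ v, transition π u v * f v) → ∀ u, f u ≤ f t := by
    intro f hf u
    have : Nonempty G.Vertex := ⟨u⟩
    obtain ⟨m, hm⟩ := Finite.exists_max f
    -- the set of maximizers is closed under transitions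
    have hstep : ∀ x y, 0 < transition π x y → f x = f m → f y = f m := by
      intro x y hxy hx
      by_contra hne
      have hlt : f y < f m := lt_of_le_of_ne (hm y) hne
      have : ∑ v, transition π x v * f v < ∑ v, transition π x v * f m :=
        Finset.sum_lt_sum
          (fun v _ => mul_le_mul_of_nonneg_left (hm v) (transition_nonneg π x v))
          ⟨y, Finset.mem_univ _, mul_lt_mul_of_pos_left hlt hxy⟩
      rw [← Finset.sum_mul, sum_transition, one_mul, ← hf] at this
      exact this.ne hx
    have hpath : ∀ x, Relation.ReflTransGen (fun x y => 0 < transition π x y) m x → f x = f m := by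
      intro x hx
      induction hx with
      | refl => rfl
      | tail _ hxy ih => exact hstep _ _ hxy ih
    rw [hpath t (h m)]
    exact hm u
  refine le_antisymm (key f hf u) ?_
  have := key (fun v => - f v) (fun v => by
    simp only [mul_neg, Finset.sum_neg_distrib]; rw [← hf]) u
  simpa using this

lemma Reaches.isSink_of_agentOut {π : G.Policy} {s : G.Agent} (h : Reaches π (.inl s))
    (hs : G.agentOut s = {.inl s}) (hr : G.reward s (.inl s) = 0) : G.IsSink s := by
  refine ⟨hs, hr, fun v => Relation.ReflTransGen.mono ?_ _ _ (h v)⟩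
  rintro (a | x) y hxy
  · simp only [transition] at hxy
    split_ifs at hxy with hy
    · rw [hy]; exact π.2 a
    · exact absurd hxy (lt_irrefl _)
  · simp only [transition] at hxy
    split_ifs at hxy with hy
    · exact hy
    · exact absurd hxy (lt_irrefl _)

lemma policy_sink (π : G.Policy) {s : G.Agent} (hs : G.agentOut s = {.inl s}) :
    π.1 s = .inl s := by
  have := π.2 s
  rwa [hs, Finset.mem_singleton] at this

/-- The probabilities of having reached a sink increase with the number of steps; their limit is
harmonic, hence constant. -/
lemma Reaches.weakUnichain {π : G.Policy} {s : G.Agent} (h : Reaches π (.inl s))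
    (hs : G.IsSink s) : WeakUnichain π := by
  refine ⟨s, hs, ?_⟩
  have hπ := policy_sink π hs.1
  set M := transition π with hM
  have hrow : ∀ k v, (M ^ (k + 1)) v (Sum.inl s) = ∑ w, M v w * (M ^ k) w (Sum.inl s) := by
    intro k v
    rw [pow_succ', Matrix.mul_apply]
  have h01 : ∀ k v, 0 ≤ (M ^ k) v (Sum.inl s) ∧ (M ^ k) v (Sum.inl s) ≤ 1 := by
    intro k
    induction k with
    | zero =>
      intro v
      rw [pow_zero, Matrix.one_apply]
      split_ifs <;> norm_num
    | succ k ih =>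
      intro v
      rw [hrow]
      refine ⟨Finset.sum_nonneg fun w _ => mul_nonneg (transition_nonneg π v w) (ih w).1, ?_⟩
      calc ∑ w, M v w * (M ^ k) w (Sum.inl s) ≤ ∑ w, M v w * 1 :=
            Finset.sum_le_sum fun w _ =>
              mul_le_mul_of_nonneg_left (ih w).2 (transition_nonneg π v w)
        _ = 1 := by simp only [mul_one]; exact sum_transition π v
  have hsink : ∀ k, (M ^ k) (Sum.inl s) (Sum.inl s) = 1 := by
    intro k
    induction k with
    | zero => simp
    | succ k ih =>
      rw [hrow, hM, sum_transition_mul]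
      simp only [hπ]
      exact ih
  have hmono : ∀ v, Monotone fun k => (M ^ k) v (Sum.inl s) := by
    intro v
    refine monotone_nat_of_le_succ fun k => ?_
    rw [pow_succ, Matrix.mul_apply]
    calc (M ^ k) v (Sum.inl s) = (M ^ k) v (Sum.inl s) * M (Sum.inl s) (Sum.inl s) := by
          simp [hM, transition, hπ]
      _ ≤ _ := Finset.single_le_sum
          (f := fun w => (M ^ k) v w * M w (Sum.inl s))
          (fun w _ => mul_nonneg (by
            have hnn : ∀ k u w, 0 ≤ (M ^ k) u w := by
              intro k
              induction k with
              | zero => intro u w; rw [pow_zero, Matrix.one_apply]; split_ifs <;> norm_num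
              | succ k ih =>
                intro u w
                rw [pow_succ, Matrix.mul_apply]
                exact Finset.sum_nonneg fun z _ => mul_nonneg (ih u z) (transition_nonneg π z w)
            exact hnn k v w) (transition_nonneg π w _)) (Finset.mem_univ _)
  have hlim : ∀ v, ∃ l, Tendsto (fun k => (M ^ k) v (Sum.inl s)) atTop (𝓝 l) := fun v =>
    ⟨_, tendsto_atTop_ciSup (hmono v) ⟨1, by rintro _ ⟨k, rfl⟩; exact (h01 k v).2⟩⟩
  choose l hl using hlim
  have hharm : ∀ u, l u = ∑ v, transition π u v * l v := by
    intro u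
    refine tendsto_nhds_unique ((tendsto_add_atTop_iff_nat 1).2 (hl u)) ?_
    simp only [hrow]
    exact tendsto_finsetSum _ fun w _ => (hl w).const_mul _
  intro v
  have h1 : l (Sum.inl s) = 1 := by
    refine tendsto_nhds_unique (hl _) ?_
    simp only [hsink]
    exact tendsto_const_nhds
  rw [← h1, ← h.eq_of_harmonic hharm v]
  exact hl v

lemma Reaches.value_eq {π : G.Policy} {s : G.Agent} (h : Reaches π (.inl s)) (hs : G.IsSink s)
    {val : G.Vertex → ℝ} (hval : IsValue π val) : value π = val := by
  have huniq : ∀ w, IsValue π w → w = val := by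
    intro w hw
    funext u
    have := h.eq_of_harmonic (f := fun u => w u - val u) (fun u => by
      rw [sum_transition_mul π (fun u => w u - val u)]
      rcases u with a | x
      · dsimp only
        rw [hw.1, hval.1]; ring
      · dsimp only
        rw [hw.2.1, hval.2.1, ← Finset.sum_sub_distrib]
        exact Finset.sum_congr rfl fun v _ => by ring) u
    simp only [hw.2.2 s hs, hval.2.2 s hs, sub_self] at this
    linarith
  have hex : ∃! val : G.Vertex → ℝ, IsValue π val := ⟨val, hval, huniq⟩
  unfold value
  rw [dif_pos hex]
  exact huniq _ hex.choose_spec.1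

end MDP

/-! ### The process -/

namespace BinaryCounter

section Construction

/-- The agent vertices: two terminal vertices, of which `false` is the sink, and the cells of the
`n` levels. -/
abbrev AgentVertex (n : ℕ) : Type := Bool ⊕ Fin n × Cell

/-- The randomization vertices: for every level one that averages the two targets of the level, and
for every cell one for each choice. -/
abbrev RandVertex (n : ℕ) : Type := Fin n ⊕ Fin n × Cell × Bool

/-- The two targets of level `k`. -/
def target {n : ℕ} : ∀ k, k ≤ n → Bool → AgentVertex n ⊕ RandVertex n
  | 0, _, c => .inl (.inl c)
  | k + 1, h, false => .inl (.inr (⟨k, h⟩, (false, false)))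
  | k + 1, h, true => .inr (.inl ⟨k, h⟩)

variable {n : ℕ} {p : ℕ → ℝ}

lemma target_ne {k : ℕ} (h : k ≤ n) : target k h false ≠ target k h true := by
  cases k <;> simp [target]

lemma target_ne_cell (k : Fin n) (x : Cell) (c : Bool) :
    target k.1 k.2.le c ≠ .inl (.inr (k, x)) := by
  obtain ⟨k, hk⟩ := k
  cases k <;> cases c <;> simp [target]

/-- The process with `n` levels, in which a choice `c` in a cell of level `k` leads to the target
`c` with probability `p k`, and to the mate `mate c _` otherwise. The only reward, `1`, is collected
on the edge from the terminal vertex `true` to the sink. -/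
noncomputable abbrev process (n : ℕ) (p : ℕ → ℝ) (hp : ∀ k, 0 < p k ∧ p k ≤ 1 / 4) : MDP where
  Agent := AgentVertex n
  Rand := RandVertex n
  agentOut
    | .inl _ => {.inl (.inl false)}
    | .inr (k, x) => {.inr (.inr (k, x, false)), .inr (.inr (k, x, true))}
  randOut
    | .inl k => {target k.1 k.2.le false, target k.1 k.2.le true}
    | .inr (k, x, c) => {target k.1 k.2.le c, .inl (.inr (k, mate c x))}
  reward u _ := if u = .inl true then 1 else 0
  prob
    | .inl _, _ => 1 / 2
    | .inr (k, x, c), v => if v = .inl (.inr (k, mate c x)) then 1 - p k else p k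
  agentOut_nonempty := by rintro (_ | ⟨k, x⟩) <;> simp
  randOut_nonempty := by rintro (k | ⟨k, x, c⟩) <;> simp
  prob_mem := by
    rintro (k | ⟨k, x, c⟩) v -
    · norm_num
    · have := hp k
      dsimp only
      split_ifs <;> constructor <;> linarith
  prob_sum := by
    rintro (k | ⟨k, x, c⟩)
    · dsimp only
      rw [Finset.sum_pair (target_ne _)]
      norm_num
    · dsimp only
      rw [Finset.sum_pair (target_ne_cell k _ c), if_neg (target_ne_cell k _ c), if_pos rfl]
      ring

lemma size_process_le (hp : ∀ k, 0 < p k ∧ p k ≤ 1 / 4) :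
    (process n p hp).size ≤ 3 * (13 * n + 2) := by
  have hcard : Fintype.card (process n p hp).Vertex = 13 * n + 2 := by
    simp [Fintype.card_sum, Fintype.card_prod]
    omega
  have hout : ∀ v, ((process n p hp).out v).card ≤ 2 := by
    rintro ((_ | ⟨k, x⟩) | (k | ⟨k, x, c⟩))
    · simp [MDP.out]
    all_goals exact Finset.card_le_two
  have := Finset.sum_le_card_nsmul Finset.univ (fun v => ((process n p hp).out v).card) 2
    fun v _ => hout v
  rw [Finset.card_univ, hcard] at this
  rw [MDP.size, hcard]
  simp only [smul_eq_mul] at this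
  omega

variable {hp : ∀ k, 0 < p k ∧ p k ≤ 1 / 4}

/-- The choices of the policy `π`, continued by `false` beyond the `n` levels. -/
def bits (π : (process n p hp).Policy) (k : ℕ) (x : Cell) : Bool :=
  if h : k < n then decide (π.1 (.inr (⟨k, h⟩, x)) = .inr (.inr (⟨k, h⟩, x, true))) else false

lemma policy_cell (π : (process n p hp).Policy) (k : Fin n) (x : Cell) :
    π.1 (.inr (k, x)) = .inr (.inr (k, x, bits π k x)) := by
  have h := π.2 (.inr (k, x))
  simp only [Finset.mem_insert, Finset.mem_singleton] at h
  rcases h with h | h <;> simp [bits, h]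

lemma policy_terminal (π : (process n p hp).Policy) (c : Bool) :
    π.1 (.inl c) = .inl (.inl false) := by
  simpa using π.2 (.inl c)

lemma reaches_sink (π : (process n p hp).Policy) :
    MDP.Reaches π (.inl (.inl false)) := by
  have hagent : ∀ a, 0 < MDP.transition π (.inl a) (π.1 a) := by
    intro a; simp [MDP.transition]
  have hhalf : ∀ (k : Fin n) (c : Bool),
      0 < MDP.transition π (.inr (.inl k)) (target k.1 k.2.le c) := by
    intro k c
    simp only [MDP.transition]
    rw [if_pos (by cases c <;> simp)]
    norm_num
  have hexit : ∀ (k : Fin n) (x : Cell) (c : Bool),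
      0 < MDP.transition π (.inr (.inr (k, x, c))) (target k.1 k.2.le c) := by
    intro k x c
    simp only [MDP.transition]
    rw [if_pos (by simp), if_neg (target_ne_cell k _ c)]
    exact (hp k).1
  have hterm : ∀ c : Bool, Relation.ReflTransGen (fun x y => 0 < MDP.transition π x y)
      (.inl (.inl c)) (.inl (.inl false)) := by
    intro c
    have := hagent (.inl c)
    rw [policy_terminal] at this
    exact .single this
  have htarget : ∀ k (h : k ≤ n) c, Relation.ReflTransGen
      (fun x y => 0 < MDP.transition π x y) (target k h c) (.inl (.inl false)) := by
    intro k
    induction k with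
    | zero => intro h c; exact hterm c
    | succ k ih =>
      intro h c
      cases c
      · have h1 := hagent (.inr (⟨k, h⟩, (false, false)))
        rw [policy_cell] at h1
        exact .head h1 (.head (hexit _ _ _) (ih _ _))
      · exact .head (hhalf ⟨k, h⟩ false) (ih _ _)
  rintro ((c | ⟨k, x⟩) | (k | ⟨k, x, c⟩))
  · exact hterm c
  · have h1 := hagent (.inr (k, x))
    rw [policy_cell] at h1
    exact .head h1 (.head (hexit _ _ _) (htarget _ _ _))
  · exact .head (hhalf k false) (htarget _ _ _)
  · exact .head (hexit k x c) (htarget _ _ _)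

lemma isSink_process (π : (process n p hp).Policy) :
    (process n p hp).IsSink (.inl false) :=
  (reaches_sink π).isSink_of_agentOut rfl (by simp)

theorem weakUnichain_process (π : (process n p hp).Policy) : MDP.WeakUnichain π :=
  (reaches_sink π).weakUnichain (isSink_process π)

/-- The value of the target `c` of level `k`, for the choices `s`. -/
noncomputable def targetValue (p : ℕ → ℝ) (s : ℕ → Cell → Bool) (k : ℕ) (c : Bool) : ℝ :=
  low p s k + bit c * gap p s k

/-- The values of all vertices, for the choices `s`. -/
noncomputable def processValue (n : ℕ) (p : ℕ → ℝ) (s : ℕ → Cell → Bool) :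
    AgentVertex n ⊕ RandVertex n → ℝ
  | .inl (.inl c) => bit c
  | .inl (.inr (k, x)) => cellValue p s k x
  | .inr (.inl k) => targetValue p s (k + 1) true
  | .inr (.inr (k, x, c)) =>
    p k * targetValue p s k c + (1 - p k) * cellValue p s k (mate c x)

lemma processValue_target (s : ℕ → Cell → Bool) (k : ℕ) (h : k ≤ n) (c : Bool) :
    processValue n p s (target k h c) = targetValue p s k c := by
  rcases k with _ | k
  · simp [target, processValue, targetValue, low, gap]
  · cases c <;> simp [target, processValue, targetValue, low, gap, bit, cellValue]

theorem value_process (π : (process n p hp).Policy) :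
    MDP.value π = processValue n p (bits π) := by
  refine (reaches_sink π).value_eq (isSink_process π) ⟨?_, ?_, ?_⟩
  · rintro (c | ⟨k, x⟩)
    · rw [policy_terminal]
      cases c <;> simp [processValue, bit]
    · rw [policy_cell]
      simp only [processValue, cellValue, targetValue, reduceCtorEq, if_false]
      rw [share_eq (hp k).1 (hp k).2]
      ring
  · rintro (k | ⟨k, x, c⟩)
    · dsimp only
      rw [Finset.sum_pair (target_ne _), processValue_target, processValue_target]
      simp only [processValue, targetValue, low, gap, bit]
      simp
      ring
    · dsimp only
      rw [Finset.sum_pair (target_ne_cell k _ c), if_neg (target_ne_cell k _ c), if_pos rfl,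
        processValue_target]
      rfl
  · rintro (c | ⟨k, x⟩) hs
    · have := hs.1
      cases c
      · simp [processValue, bit]
      · simp at this
    · have := hs.1
      have h2 : (Sum.inr (Sum.inr (k, x, false)) : (process n p hp).Vertex) ∈
        (process n p hp).agentOut (.inr (k, x)) := by simp
      rw [this] at h2
      simp at h2

/-- The edge to which the policy `π` can switch in the cell `x` of level `k`. -/
def flipEdge (π : (process n p hp).Policy) (k : Fin n) (x : Cell) :
    (process n p hp).AgentEdge :=
  ⟨(.inr (k, x), .inr (.inr (k, x, !bits π k x))), by cases bits π k x <;> simp⟩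

lemma reducedCost_flipEdge (π : (process n p hp).Policy) (k : Fin n) (x : Cell) :
    MDP.reducedCost π (flipEdge π k x) =
      gap p (bits π) k * advantage (p k) (bits π k) x := by
  simp only [MDP.reducedCost, flipEdge, value_process, processValue, advantage, cellValue,
    targetValue, reduceCtorEq, if_false]
  ring

/-- The edges used by `π` have reduced cost zero, so all improving switches reverse a choice. -/
lemma exists_flipEdge {π : (process n p hp).Policy} {e : (process n p hp).AgentEdge}
    (he : MDP.IsImproving π e) : ∃ k x, e = flipEdge π k x := by
  obtain ⟨⟨u, v⟩, hv⟩ := e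
  rw [MDP.IsImproving] at he
  rcases u with c | ⟨k, x⟩
  · exfalso
    have hv' : v = .inl (.inl false) := by simpa using hv
    subst hv'
    cases c <;> simp [MDP.reducedCost, value_process, processValue, bit] at he
  · refine ⟨k, x, ?_⟩
    obtain ⟨c, hc⟩ : ∃ c, v = .inr (.inr (k, x, c)) := by
      simp only [Finset.mem_insert, Finset.mem_singleton] at hv
      rcases hv with h | h
      exacts [⟨_, h⟩, ⟨_, h⟩]
    subst hc
    by_cases hcb : c = bits π k x
    · exfalso
      subst hcb
      simp only [MDP.reducedCost, value_process, processValue, cellValue,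
        targetValue, reduceCtorEq, if_false] at he
      rw [share_eq (hp k).1 (hp k).2 (bits π k) x] at he
      ring_nf at he
      exact lt_irrefl _ he
    · have : c = !bits π k x := by cases c <;> simpa using hcb
      subst this
      rfl

lemma bits_applySwitch (π : (process n p hp).Policy) (k : Fin n) (x : Cell) :
    bits (MDP.applySwitch π (flipEdge π k x)) = flip (bits π) k x := by
  funext j y
  by_cases hj : j < n
  · by_cases hjk : j = k
    · subst hjk
      rw [flip_self]
      by_cases hy : y = x
      · subst hy
        rw [toggle_self]
        simp [bits, MDP.applySwitch, flipEdge]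
      · rw [toggle_of_ne hy]
        simp [bits, MDP.applySwitch, flipEdge, hy]
    · rw [flip_of_ne hjk]
      have : (⟨j, hj⟩ : Fin n) ≠ k := fun h => hjk (congrArg Fin.val h)
      simp [bits, MDP.applySwitch, flipEdge, hj, this]
  · have hjk : j ≠ k := fun h => hj (h ▸ k.2)
    rw [flip_of_ne hjk]
    simp [bits, hj]

end Construction

/-! ### The three pivot rules -/

section Rules

variable {n : ℕ} {p : ℕ → ℝ} {hp : ∀ k, 0 < p k ∧ p k ≤ 1 / 4} {A : Cell → Prop}
  {π : (process n p hp).Policy} {s : ℕ → Cell → Bool}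

lemma sgn_mul_self (d : Bool) : sgn d * sgn d = 1 := by cases d <;> simp [sgn]

lemma mul_le_mul_of_sgn {d : Bool} {g a b : ℝ} (hg : 0 ≤ sgn d * g) (h : sgn d * a ≤ sgn d * b) :
    a * g ≤ b * g := by
  cases d <;> simp only [sgn] at hg h <;> simp at hg h <;> nlinarith

lemma mul_lt_mul_of_sgn {d : Bool} {g a b : ℝ} (hg : 0 < sgn d * g) (h : sgn d * a < sgn d * b) :
    a * g < b * g := by
  cases d <;> simp only [sgn] at hg h <;> simp at hg h <;> nlinarith

lemma mul_le_mul_add_of_sgn {d : Bool} {g a b η : ℝ} (hg : 0 ≤ sgn d * g) (hg1 : sgn d * g ≤ 1)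
    (hη : 0 ≤ η) (h : sgn d * a ≤ sgn d * b + η) : a * g ≤ b * g + η := by
  cases d <;> simp only [sgn] at hg hg1 h <;> simp at hg hg1 h <;> nlinarith

lemma Inv.gap_bounds (hp : ∀ k, 0 < p k ∧ p k ≤ 1 / 4) (hI : Inv A n s) {k : ℕ} (hk : k < n) :
    (1 / 4 : ℝ) ^ n ≤ sgn (desired s k) * gap p s k ∧ sgn (desired s k) * gap p s k ≤ 1 := by
  obtain ⟨h1, h2⟩ := BinaryCounter.gap_bounds (fun k => (hp k).1) (fun k => (hp k).2)
    fun j (hj : j < k) => hI.good j (hj.trans hk)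
  exact ⟨(pow_le_pow_of_le_one (by norm_num) (by norm_num) hk.le).trans h1, h2⟩

lemma reducedCost_flipEdge_eq (d : Bool) (k : Fin n) (x : Cell) :
    MDP.reducedCost π (flipEdge π k x) =
      (sgn d * gap p (bits π) k) * (sgn d * advantage (p k) (bits π k) x) := by
  rw [reducedCost_flipEdge]
  linear_combination (-gap p (bits π) k * advantage (p k) (bits π k) x) * sgn_mul_self d

lemma isImproving_flipEdge_iff (hI : Inv A n (bits π)) (k : Fin n) (x : Cell) :
    MDP.IsImproving π (flipEdge π k x) ↔ bits π k x = !desired (bits π) k := by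
  have hpos : (0 : ℝ) < (1 / 4) ^ n := by positivity
  have := (hI.gap_bounds hp k.2).1
  rw [MDP.IsImproving, reducedCost_flipEdge_eq (desired (bits π) k),
    mul_pos_iff_of_pos_left (by linarith),
    advantage_pos_iff (hp k).1 (hp k).2 (hI.good k k.2)]

lemma eq_const_of_not_isImproving (hI : Inv A n (bits π)) (k : Fin n)
    (h : ∀ x, ¬ MDP.IsImproving π (flipEdge π k x)) :
    bits π k = fun _ => desired (bits π) k := by
  funext x
  have := h x
  rw [isImproving_flipEdge_iff hI] at this
  simpa using this

/-- A rule all of whose switches are moves of the counter performs exponentially many switches. -/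
theorem performsAtLeast_of_move {R : (process n p hp).PivotRule}
    (hmove : ∀ π, Inv A n (bits π) → ∀ e, R π e →
      ∃ (k : Fin n) (x : Cell), e = flipEdge π k x ∧ Move A n (bits π) k x)
    (hex : ∀ π, (∃ e, MDP.IsImproving π e) → ∃ e, R π e)
    {π₀ : (process n p hp).Policy} (h₀ : bits π₀ = fun _ _ => false) :
    MDP.PerformsAtLeast R π₀ (2 ^ n - 1) := by
  intro m hm π hrun
  have key : ∀ m π, MDP.Runs R π₀ m π → Inv A n (bits π) ∧ counter (bits π) n ≤ m := by
    intro m π hrun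
    induction hrun with
    | start => rw [h₀]; exact ⟨inv_false A n, (desired_counter_false n).2.le⟩
    | step e _ he ih =>
      obtain ⟨k, x, rfl, hmv⟩ := hmove _ ih.1 _ he
      rw [bits_applySwitch]
      have := hmv.inv ih.1
      exact ⟨this.1, this.2.trans (by omega)⟩
  obtain ⟨hI, hc⟩ := key m π hrun
  refine hex π ?_
  by_contra! hno
  have := counter_of_const fun j (hj : j < n) =>
    eq_const_of_not_isImproving hI ⟨j, hj⟩ fun x => hno _
  omega

/-- A level of smaller index than a level with an improving switch is not armed. -/
lemma Inv.idle_or_trapped (hI : Inv A n (bits π)) {j k : Fin n} (hjk : j < k) {y : Cell}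
    (hy : MDP.IsImproving π (flipEdge π k y)) :
    (bits π j = fun _ => !desired (bits π) j) ∨ Trapped (desired (bits π) j) (bits π j) := by
  rcases hI.good j j.2 with h | ⟨z, -, h⟩ | h
  · exact .inl h
  · have := hI.armed j j.2 z h k hjk k.2
    rw [isImproving_flipEdge_iff hI, this] at hy
    simp at hy
  · exact .inr h

lemma sq_div_le_reducedCost (hI : Inv A n (bits π)) {k : Fin n} {x : Cell}
    (hx : MDP.IsImproving π (flipEdge π k x)) :
    p k ^ 2 / 4 ^ n ≤ MDP.reducedCost π (flipEdge π k x) := by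
  rw [isImproving_flipEdge_iff hI] at hx
  have h1 := sq_le_advantage (hp k).1 (hp k).2 (sub_share_le (hp k).1 (hp k).2 (hI.good k k.2)) hx
  have h2 := (hI.gap_bounds hp k.2).1
  rw [reducedCost_flipEdge_eq (desired (bits π) k)]
  calc p k ^ 2 / 4 ^ n = (1 / 4) ^ n * p k ^ 2 := by rw [div_pow, one_pow]; ring
    _ ≤ _ := mul_le_mul h2 h1 (by positivity) (le_trans (by positivity) h2)

/-- An improving switch does not decrease any value, and increases the value of the vertex where it
is applied by at least its reduced cost. -/
lemma cellValue_flip (hI : Inv A n (bits π)) {k : Fin n} {x : Cell}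
    (hx : MDP.IsImproving π (flipEdge π k x)) :
    (∀ j y, cellValue p (bits π) j y ≤ cellValue p (flip (bits π) k x) j y) ∧
      cellValue p (bits π) k x + MDP.reducedCost π (flipEdge π k x) ≤
        cellValue p (flip (bits π) k x) k x := by
  have hG := (hI.gap_bounds hp k.2).1
  have hG0 : (0 : ℝ) < sgn (desired (bits π) k) * gap p (bits π) k :=
    lt_of_lt_of_le (by positivity) hG
  have hadv := (advantage_pos_iff (hp k).1 (hp k).2 (hI.good k k.2)).2
    ((isImproving_flipEdge_iff hI k x).1 hx)
  obtain ⟨h1, h2⟩ := share_toggle (hp k).1 (hp k).2 hadv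
  constructor
  · intro j y
    have := cellValue_le_add (p := p) (k := k) (fun k => (hp k).1) (fun k => (hp k).2) le_rfl
      (s := bits π) (s' := flip (bits π) k x) (fun j hj => flip_of_ne hj) (fun y => by
        rw [flip_self, add_zero]
        exact mul_le_mul_of_sgn hG0.le (h1 y)) j y
    linarith
  · obtain ⟨hl, hg⟩ := low_gap_congr (p := p) (s := bits π) (s' := flip (bits π) k x) (j := k)
      fun i hi => flip_of_ne (by omega)
    rw [reducedCost_flipEdge_eq (desired (bits π) k)]
    simp only [cellValue, hl, hg, flip_self]
    have h3 := mul_le_mul_of_sgn hG0.le (d := desired (bits π) k)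
      (a := share (p k) (bits π k) x + advantage (p k) (bits π k) x)
      (b := share (p k) (toggle (bits π k) x) x) (by linarith)
    have h4 := sgn_mul_self (desired (bits π) k)
    linear_combination h3 + advantage (p k) (bits π k) x * gap p (bits π) k * h4

/-- In a level that is not armed, a switch has only a small effect on the values. -/
lemma cellValue_flip_le (hI : Inv A n (bits π)) {j : Fin n} {x : Cell}
    (hx : MDP.IsImproving π (flipEdge π j x))
    (h : (bits π j = fun _ => !desired (bits π) j) ∨ Trapped (desired (bits π) j) (bits π j))
    (i : ℕ) (y : Cell) :
    cellValue p (flip (bits π) j x) i y ≤ cellValue p (bits π) i y + p j := by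
  obtain ⟨hG, hG1⟩ := hI.gap_bounds hp j.2
  have hG0 : (0 : ℝ) < sgn (desired (bits π) j) * gap p (bits π) j :=
    lt_of_lt_of_le (by positivity) hG
  obtain ⟨hl, hg⟩ := low_gap_congr (p := p) (s := bits π) (s' := flip (bits π) j x) (j := j)
    fun i hi => flip_of_ne (by omega)
  refine cellValue_le_add (p := p) (k := j) (fun k => (hp k).1) (fun k => (hp k).2) (hp j).1.le
    (fun i hi => (flip_of_ne hi).symm) (fun y => ?_) i y
  have := share_toggle_le (hp j).1 (hp j).2 h ((isImproving_flipEdge_iff hI j x).1 hx) y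
  rw [flip_self, hg]
  exact mul_le_mul_add_of_sgn hG0.le hG1 (hp j).1.le this

/-- The sum of the values of the agent vertices. -/
noncomputable def totalValue (n : ℕ) (p : ℕ → ℝ) (s : ℕ → Cell → Bool) : ℝ :=
  ∑ v : AgentVertex n, processValue n p s (.inl v)

lemma sum_value_applySwitch (k : Fin n) (x : Cell) :
    ∑ v : (process n p hp).Agent, MDP.value (MDP.applySwitch π (flipEdge π k x)) (.inl v) =
      totalValue n p (flip (bits π) k x) := by
  rw [value_process, bits_applySwitch]
  rfl

lemma totalValue_le_add {s s' : ℕ → Cell → Bool} {η : ℝ} (hη : 0 ≤ η)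
    (h : ∀ j y, cellValue p s j y ≤ cellValue p s' j y + η) :
    totalValue n p s ≤ totalValue n p s' + (4 * n + 2) * η := by
  have : totalValue n p s ≤ ∑ v : AgentVertex n, (processValue n p s' (.inl v) + η) := by
    refine Finset.sum_le_sum ?_
    rintro (c | ⟨k, x⟩) -
    · simp [processValue, hη]
    · exact h k x
  rw [Finset.sum_add_distrib, Finset.sum_const, Finset.card_univ] at this
  have hcard : Fintype.card (AgentVertex n) = 4 * n + 2 := by
    simp [Fintype.card_sum, Fintype.card_prod]
    omega
  rw [hcard] at this
  simpa [totalValue] using this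

lemma totalValue_add_le {s s' : ℕ → Cell → Bool} {c : ℝ}
    (h : ∀ j y, cellValue p s j y ≤ cellValue p s' j y) (k : Fin n) (x : Cell)
    (hk : cellValue p s k x + c ≤ cellValue p s' k x) :
    totalValue n p s + c ≤ totalValue n p s' := by
  have : c ≤ ∑ v : AgentVertex n, (processValue n p s' (.inl v) - processValue n p s (.inl v)) := by
    refine le_trans ?_ (Finset.single_le_sum (f := fun v : AgentVertex n =>
      processValue n p s' (.inl v) - processValue n p s (.inl v)) ?_
      (Finset.mem_univ (Sum.inr (k, x))))
    · simp only [processValue]; linarith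
    · rintro (b | ⟨k, x⟩) -
      · simp [processValue]
      · simpa [processValue] using h k x
  rw [Finset.sum_sub_distrib] at this
  unfold totalValue
  linarith

/-- Firing an armed level increases the sum of the values more than any other switch of the
level. -/
lemma totalValue_fire (hI : Inv A n (bits π)) {k : Fin n} {x y : Cell}
    (hy : bits π k = toggle (fun _ => !desired (bits π) k) y)
    (hxy : x ≠ y) (hm : x ≠ mate (desired (bits π) k) y) :
    totalValue n p (flip (bits π) k x) <
      totalValue n p (flip (bits π) k (mate (desired (bits π) k) y)) := by
  obtain ⟨hG, -⟩ := hI.gap_bounds hp k.2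
  have hG0 : (0 : ℝ) < sgn (desired (bits π) k) * gap p (bits π) k :=
    lt_of_lt_of_le (by positivity) hG
  set d := desired (bits π) k with hd
  have hlg : ∀ x, low p (flip (bits π) k x) k = low p (bits π) k ∧
      gap p (flip (bits π) k x) k = gap p (bits π) k := fun x =>
    low_gap_congr fun i hi => flip_of_ne (by omega)
  obtain ⟨h1, h2⟩ := armed_toggle_lt (hp k).1 (hp k).2 hxy hm
  have hle : ∀ i z, cellValue p (flip (bits π) k x) i z ≤
      cellValue p (flip (bits π) k (mate d y)) i z := by
    intro i z
    have := cellValue_le_add (p := p) (k := k) (fun k => (hp k).1) (fun k => (hp k).2) le_rfl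
      (s := flip (bits π) k x) (s' := flip (bits π) k (mate d y))
      (fun j hj => by rw [flip_of_ne hj, flip_of_ne hj]) (fun z => by
        rw [flip_self, flip_self, add_zero, (hlg x).2, hy]
        exact mul_le_mul_of_sgn hG0.le (h1 z)) i z
    linarith
  have hlt : cellValue p (flip (bits π) k x) k (mate d y) <
      cellValue p (flip (bits π) k (mate d y)) k (mate d y) := by
    simp only [cellValue, hlg, flip_self]
    rw [hy]
    linarith [mul_lt_mul_of_sgn hG0 h2]
  have := totalValue_add_le (n := n) hle k (mate d y)
    (c := cellValue p (flip (bits π) k (mate d y)) k (mate d y) -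
      cellValue p (flip (bits π) k x) k (mate d y)) (by linarith)
  linarith

/-- An improving switch is a move if it is in the last possible level and respects the conditions on
idle and on armed levels. -/
lemma exists_move (hI : Inv A n (bits π)) {e : (process n p hp).AgentEdge}
    (he : MDP.IsImproving π e)
    (hbelow : ∀ j k x y, e = flipEdge π j x → j < k → ¬ MDP.IsImproving π (flipEdge π k y))
    (harm : ∀ k x, e = flipEdge π k x → (bits π k = fun _ => !desired (bits π) k) → A x)
    (hfire : ∀ k x y, e = flipEdge π k x →
      bits π k = toggle (fun _ => !desired (bits π) k) y → A y → x ≠ y →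
      MDP.IsImproving π (flipEdge π k (mate (desired (bits π) k) y)) →
      x = mate (desired (bits π) k) y) :
    ∃ (k : Fin n) (x : Cell), e = flipEdge π k x ∧ Move A n (bits π) k x := by
  obtain ⟨k, x, rfl⟩ := exists_flipEdge he
  have hx := (isImproving_flipEdge_iff hI k x).1 he
  refine ⟨k, x, rfl, k.2, hx, ?_, harm k x rfl, ?_⟩
  · intro j hkj hj
    exact eq_const_of_not_isImproving hI ⟨j, hj⟩ fun y => hbelow k ⟨j, hj⟩ x y rfl hkj
  · intro y hy
    have hA : A y := by
      rcases hI.good k k.2 with h | ⟨z, hz, h⟩ | h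
      · have := congrFun (h.symm.trans hy) y
        simp [toggle_self] at this
      · have : z = y := by
          by_contra hne
          have := congrFun (h.symm.trans hy) z
          rw [toggle_self, toggle_of_ne hne] at this
          simp at this
        exact this ▸ hz
      · rw [hy] at h
        exact absurd h (not_trapped_armed _ _)
    refine hfire k x y rfl hy hA ?_ ?_
    · rintro rfl
      rw [hy, toggle_self] at hx
      simp at hx
    · rw [isImproving_flipEdge_iff hI, hy, toggle_of_ne (mate_ne _ _)]

lemma dantzig_move
    (hgap : ∀ j k, j < k → k < n → (4 * n + 2) * p j < p k ^ 2 / 4 ^ n)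
    (hI : Inv (fun _ => True) n (bits π)) (e : (process n p hp).AgentEdge)
    (he : MDP.dantzigRule π e) :
    ∃ (k : Fin n) (x : Cell), e = flipEdge π k x ∧ Move (fun _ => True) n (bits π) k x := by
  refine exists_move hI he.1 ?_ (fun _ _ _ _ => trivial) ?_
  -- the reduced cost in level `j` is at most `p j`, since it bounds the gain in value from below
  · rintro j k x y rfl hjk hy
    have h1 := (cellValue_flip hI he.1).2
    have h2 := cellValue_flip_le hI he.1 (hI.idle_or_trapped hjk hy) j x
    have h3 := sq_div_le_reducedCost hI hy
    have h4 := hgap j k hjk k.2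
    have h5 := he.2 _ hy
    have h6 := (hp j).1
    have h7 : (0 : ℝ) ≤ n := n.cast_nonneg
    nlinarith
  · rintro k x y rfl hy - hxy himp
    by_contra hm
    have h1 := he.2 _ himp
    have hG0 : (0 : ℝ) < sgn (desired (bits π) k) * gap p (bits π) k :=
      lt_of_lt_of_le (by positivity) (hI.gap_bounds hp k.2).1
    rw [reducedCost_flipEdge_eq (desired (bits π) k),
      reducedCost_flipEdge_eq (desired (bits π) k)] at h1
    have h2 := le_of_mul_le_mul_left h1 hG0
    rw [hy] at h2
    exact (armed_advantage_lt (hp k).1 (hp k).2 hxy hm).not_ge h2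

lemma largestIncrease_move
    (hgap : ∀ j k, j < k → k < n → (4 * n + 2) * p j < p k ^ 2 / 4 ^ n)
    (hI : Inv (fun _ => True) n (bits π)) (e : (process n p hp).AgentEdge)
    (he : MDP.largestIncreaseRule π e) :
    ∃ (k : Fin n) (x : Cell), e = flipEdge π k x ∧ Move (fun _ => True) n (bits π) k x := by
  refine exists_move hI he.1 ?_ (fun _ _ _ _ => trivial) ?_
  · rintro j k x y rfl hjk hy
    have h1 := totalValue_le_add (n := n) (hp j).1.le
      (cellValue_flip_le hI he.1 (hI.idle_or_trapped hjk hy))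
    have h2 := totalValue_add_le (cellValue_flip hI hy).1 k y (cellValue_flip hI hy).2
    have h3 := sq_div_le_reducedCost hI hy
    have h4 := hgap j k hjk k.2
    have h5 := he.2 _ hy
    rw [sum_value_applySwitch, sum_value_applySwitch] at h5
    linarith
  · rintro k x y rfl hy - hxy himp
    by_contra hm
    have h1 := he.2 _ himp
    rw [sum_value_applySwitch, sum_value_applySwitch] at h1
    exact (totalValue_fire hI hy hxy hm).not_ge h1

/-- The order of the edges of a level in the numbering for Bland's rule. The cell `(false, false)`
comes first, so that it is the one to be armed, and is followed by its mates, so that they fire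
next. -/
def localNumber : Cell → Bool → ℕ
  | (false, false), c => c.toNat
  | (true, false), true => 2
  | (false, true), false => 3
  | (true, false), false => 4
  | (false, true), true => 5
  | (true, true), c => 6 + c.toNat

lemma localNumber_lt (x : Cell) (c : Bool) : localNumber x c < 8 := by
  revert x c; decide

lemma localNumber_inj : ∀ (x : Cell) (c : Bool) (x' : Cell) (c' : Bool),
    localNumber x c = localNumber x' c' → x = x' ∧ c = c' := by
  decide

/-- The numbering of the edges for Bland's rule: levels of larger index come first. -/
def edgeNumber (n : ℕ) : AgentVertex n → AgentVertex n ⊕ RandVertex n → ℕ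
  | .inr (k, x), .inr (.inr (_, _, c)) => 8 * (n - k) + localNumber x c
  | .inl c, _ => c.toNat
  | _, _ => 0

/-- The numbering of the agent edges for Bland's rule. -/
def number (e : (process n p hp).AgentEdge) : ℕ := edgeNumber n e.1.1 e.1.2

lemma number_flipEdge (k : Fin n) (x : Cell) :
    number (flipEdge π k x) = 8 * (n - k) + localNumber x (!bits π k x) := rfl

lemma number_injective : Function.Injective (number : (process n p hp).AgentEdge → ℕ) := by
  rintro ⟨⟨u, v⟩, hv⟩ ⟨⟨u', v'⟩, hv'⟩ h
  have hform : ∀ (k : Fin n) (x : Cell) (v : (process n p hp).Vertex),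
      v ∈ (process n p hp).agentOut (.inr (k, x)) → ∃ c, v = .inr (.inr (k, x, c)) := by
    intro k x v hv
    simp only [Finset.mem_insert, Finset.mem_singleton] at hv
    rcases hv with h | h
    exacts [⟨_, h⟩, ⟨_, h⟩]
  have hterm : ∀ (c : Bool) (v : (process n p hp).Vertex),
      v ∈ (process n p hp).agentOut (.inl c) → v = .inl (.inl false) := by
    intro c v hv
    simpa using hv
  rw [Subtype.mk.injEq]
  rcases u with c | ⟨k, x⟩ <;> rcases u' with c' | ⟨k', x'⟩
  · obtain rfl := hterm c v hv
    obtain rfl := hterm c' v' hv'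
    cases c <;> cases c' <;> simp [number, edgeNumber] at h ⊢
  · obtain ⟨b, rfl⟩ := hform _ _ _ hv'
    have := k'.2
    cases c <;> simp [number, edgeNumber] at h <;> omega
  · obtain ⟨b, rfl⟩ := hform _ _ _ hv
    have := k.2
    cases c' <;> simp [number, edgeNumber] at h <;> omega
  · obtain ⟨b, rfl⟩ := hform _ _ _ hv
    obtain ⟨b', rfl⟩ := hform _ _ _ hv'
    simp only [number, edgeNumber] at h
    have h1 := localNumber_lt x b
    have h2 := localNumber_lt x' b'
    have h3 := k.2
    have h4 := k'.2
    have hk : k = k' := Fin.ext (by omega)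
    subst hk
    obtain ⟨rfl, rfl⟩ := localNumber_inj x b x' b' (by omega)
    rfl

lemma bland_move (hI : Inv (fun x => x = (false, false)) n (bits π))
    (e : (process n p hp).AgentEdge) (he : MDP.blandRule number π e) :
    ∃ (k : Fin n) (x : Cell), e = flipEdge π k x ∧
      Move (fun x => x = (false, false)) n (bits π) k x := by
  refine exists_move hI he.1 ?_ ?_ ?_
  · rintro j k x y rfl hjk hy
    have h := he.2 _ hy
    rw [number_flipEdge, number_flipEdge] at h
    have h1 := localNumber_lt y (!bits π k y)
    have h2 := k.2
    have h3 : j.1 < k.1 := hjk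
    omega
  · rintro k x rfl hidle
    have himp : MDP.IsImproving π (flipEdge π k (false, false)) := by
      rw [isImproving_flipEdge_iff hI, hidle]
    have h := he.2 _ himp
    rw [number_flipEdge, number_flipEdge, hidle] at h
    revert h
    generalize desired (bits π) k = d
    obtain ⟨i, j⟩ := x
    cases d <;> cases i <;> cases j <;> simp [localNumber]
  · rintro k x y rfl hy rfl hxy himp
    have h := he.2 _ himp
    rw [number_flipEdge, number_flipEdge, hy, toggle_of_ne hxy, toggle_of_ne (mate_ne _ _)] at h
    revert h hxy
    generalize desired (bits π) k = d
    obtain ⟨i, j⟩ := x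
    cases d <;> cases i <;> cases j <;> simp [localNumber, mate]

lemma exists_isImproving_max (f : (process n p hp).AgentEdge → ℝ)
    (h : ∃ e, MDP.IsImproving π e) :
    ∃ e, MDP.IsImproving π e ∧ ∀ e', MDP.IsImproving π e' → f e' ≤ f e := by
  obtain ⟨e, he, hmax⟩ := Set.exists_max_image {e | MDP.IsImproving π e} f (Set.toFinite _) h
  exact ⟨e, he, hmax⟩

lemma exists_blandRule (h : ∃ e, MDP.IsImproving π e) : ∃ e, MDP.blandRule number π e := by
  obtain ⟨e, he, hmin⟩ := Set.exists_min_image {e | MDP.IsImproving π e} number (Set.toFinite _) h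
  exact ⟨e, he, hmin⟩

end Rules

/-- The exit probabilities in level `k` of the process with `n` levels. Each is at most the cube of
the next one, because a switch in level `k` may have a reduced cost as small as the square of its
exit probability, which has to exceed the effect of a switch in level `k - 1` on the sum of all
values. -/
noncomputable def exitProb (n k : ℕ) : ℝ := (1 / ((4 * n + 4) * 4 ^ n)) ^ 3 ^ (n - 1 - k)

lemma exitProb_base (n : ℕ) :
    0 < (1 / ((4 * n + 4) * 4 ^ n) : ℝ) ∧ (1 / ((4 * n + 4) * 4 ^ n) : ℝ) ≤ 1 / 4 := by
  refine ⟨by positivity, one_div_le_one_div_of_le (by norm_num) ?_⟩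
  have h1 : (1 : ℝ) ≤ 4 ^ n := one_le_pow₀ (by norm_num)
  have h2 : (0 : ℝ) ≤ n := n.cast_nonneg
  nlinarith

lemma exitProb_bounds (n k : ℕ) : 0 < exitProb n k ∧ exitProb n k ≤ 1 / 4 := by
  obtain ⟨h1, h2⟩ := exitProb_base n
  refine ⟨pow_pos h1 _, ?_⟩
  exact (pow_le_of_le_one h1.le (by linarith) (by positivity)).trans h2

lemma exitProb_gap (n j k : ℕ) (hjk : j < k) (hk : k < n) :
    (4 * n + 2) * exitProb n j < exitProb n k ^ 2 / 4 ^ n := by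
  obtain ⟨h1, h2⟩ := exitProb_base n
  have hn : (0 : ℝ) ≤ n := n.cast_nonneg
  have hk0 := (exitProb_bounds n k).1
  have hle : exitProb n j ≤ exitProb n k ^ 3 := by
    unfold exitProb
    rw [← pow_mul]
    refine pow_le_pow_of_le_one h1.le (by linarith) ?_
    rw [← pow_succ]
    exact Nat.pow_le_pow_right (by norm_num) (by omega)
  have hle2 : exitProb n k ≤ 1 / ((4 * n + 4) * 4 ^ n) :=
    pow_le_of_le_one h1.le (by linarith) (by positivity)
  calc (4 * n + 2) * exitProb n j ≤ (4 * n + 2) * exitProb n k ^ 3 := by gcongr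
    _ = exitProb n k ^ 2 * ((4 * n + 2) * exitProb n k) := by ring
    _ < exitProb n k ^ 2 * (1 / 4 ^ n) := by
        have : (4 * n + 2) * exitProb n k < 1 / (4 ^ n : ℝ) := by
          calc (4 * n + 2) * exitProb n k ≤ (4 * n + 2) * (1 / ((4 * n + 4) * 4 ^ n)) := by gcongr
            _ < (4 * n + 4) * (1 / ((4 * n + 4) * 4 ^ n)) := by gcongr; norm_num
            _ = 1 / 4 ^ n := by field_simp
        gcongr
    _ = _ := by ring

/-- The process that is hard for all three pivot rules. -/
noncomputable abbrev counterProcess (n : ℕ) : MDP := process n (exitProb n) (exitProb_bounds n)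

/-- The policy that makes the choice `false` in every cell. -/
def initialPolicy (n : ℕ) : (counterProcess n).Policy :=
  ⟨fun
    | .inl _ => .inl (.inl false)
    | .inr (k, x) => .inr (.inr (k, x, false)), by
    rintro (_ | ⟨k, x⟩) <;> simp⟩

lemma bits_initialPolicy (n : ℕ) :
    bits (hp := exitProb_bounds n) (initialPolicy n) = fun _ _ => false := by
  funext k x
  simp [bits, initialPolicy]

end BinaryCounter

/-! ### The lower bound -/

open BinaryCounter in
theorem theorem1 :
    ∃ (D : ℕ → MDP) (π₀ : ∀ n, (D n).Policy) (num : ∀ n, (D n).AgentEdge → ℕ) (N : ℕ → ℕ),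
      -- the size of `D n` is `O(n)`
      ((fun n => ((D n).size : ℝ)) =O[atTop] fun n => (n : ℝ)) ∧
      -- every policy visited by policy iteration, whatever the choices, is weak unichain
      (∀ n k π, MDP.Runs MDP.IsImproving (π₀ n) k π → MDP.WeakUnichain π) ∧
      -- the numbering for Bland's rule gives distinct numbers to distinct agent edges
      (∀ n, Function.Injective (num n)) ∧
      -- `N n` is `Ω(2 ^ n)`
      ((fun n => (2 : ℝ) ^ n) =O[atTop] fun n => (N n : ℝ)) ∧
      ∀ n, MDP.PerformsAtLeast MDP.dantzigRule (π₀ n) (N n) ∧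
        MDP.PerformsAtLeast (MDP.blandRule (num n)) (π₀ n) (N n) ∧
        MDP.PerformsAtLeast MDP.largestIncreaseRule (π₀ n) (N n) := by
  refine ⟨counterProcess, initialPolicy, fun n => number (hp := exitProb_bounds n),
    fun n => 2 ^ n - 1, ?_, fun n k π _ => weakUnichain_process (hp := exitProb_bounds n) π,
    fun n => number_injective, ?_, fun n => ⟨?_, ?_, ?_⟩⟩
  · refine IsBigO.of_bound 45 ?_
    filter_upwards [eventually_ge_atTop 1] with n hn
    rw [Real.norm_natCast, Real.norm_natCast]
    have h1 := size_process_le (n := n) (exitProb_bounds n)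
    have h2 : (counterProcess n).size ≤ 45 * n := h1.trans (by omega)
    exact_mod_cast h2
  · refine IsBigO.of_bound 2 ?_
    filter_upwards [eventually_ge_atTop 1] with n hn
    have h1 : 2 ≤ 2 ^ n := by
      calc 2 = 2 ^ 1 := rfl
        _ ≤ 2 ^ n := Nat.pow_le_pow_right (by norm_num) hn
    have h2 : 2 ^ n ≤ 2 * (2 ^ n - 1) := by omega
    rw [Real.norm_natCast, norm_pow, Real.norm_ofNat]
    exact_mod_cast h2
  · exact performsAtLeast_of_move (fun π hI => dantzig_move (exitProb_gap n) hI)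
      (fun π h => exists_isImproving_max _ h) (bits_initialPolicy n)
  · exact performsAtLeast_of_move (fun π hI => bland_move hI) (fun π h => exists_blandRule h)
      (bits_initialPolicy n)
  · exact performsAtLeast_of_move (fun π hI => largestIncrease_move (exitProb_gap n) hI)
      (fun π h => exists_isImproving_max
        (fun e => ∑ v, MDP.value (MDP.applySwitch π e) (.inl v)) h) (bits_initialPolicy n)
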